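/- Let $\mathcal X,\mathcal Y,\widehat{\mathcal Y}$ be measurable spaces such that singletons in $\mathcal X$ and $\mathcal Y$ are measurable. An *algorithm* is a map $\mathcal A:\bigcup_{m\ge 0}(\mathcal X\times\mathcal Y)^m\times[0,1]\to\{\text{measurable functions }\mathcal X\to\widehat{\mathcal Y}\}$ such that, for each $m$, $(D,\xi,x)\mapsto[\mathcal A(D;\xi)](x)$ is measurable on $(\mathcal X\times\mathcal Y)^m\times[0,1]\times\mathcal X$. Let $\psi:\widehat{\mathcal Y}\times\widehat{\mathcal Y}\times\mathcal Y\to\mathbb R$ be measurable with $\psi(y',y'',y)=-\psi(y'',y',y)$. For a probability measure $P$ on $\mathcal X\times\mathcal Y$, for measurable $f_0,f_1:\mathcal X\to\widehat{\mathcal Y}$, and for algorithms $\mathcal A_0,\mathcal A_1$, put \[\Delta_P(f_0,f_1)=\mathbb E_P[\psi(f_0(X),f_1(X),Y)],\qquad \Delta_P^{\max}=\sup_{f_0,f_1}\Delta_P(f_0,f_1),\qquad \Delta_{P,n}(\mathcal A_0,\mathcal A_1)=\mathbb E\big[\Delta_P(\widehat f_{0,n},\widehat f_{1,n})\big],\]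 \[\beta_q(\mathcal A_0,\mathcal A_1,P,n)=\max_{1\le j\le n}\mathbb E\Big[\big|\psi(\widehat f_{0,n}(X_{n+1}),\widehat f_{1,n}(X_{n+1}),Y_{n+1})-\psi(\widehat f^{-j}_{0,n}(X_{n+1}),\widehat f^{-j}_{1,n}(X_{n+1}),Y_{n+1})\big|^q\Big]^{1/q},\] where $(X_1,Y_1),\dots,(X_{n+1},Y_{n+1})$ are i.i.d. from $P$, $\xi\sim\mathrm{Unif}[0,1]$ is independent of them, $\widehat f_{l,n}=\mathcal A_l(((X_i,Y_i))_{i\le n};\xi)$ and $\widehat f^{-j}_{l,n}=\mathcal A_l(((X_i,Y_i))_{i\le n,\,i\ne j};\xi)$ for $l=0,1$. A *black-box test* $\widehat T$ takes $\mathcal A_0,\mathcal A_1$ and a data set $\mathcal D_N\in(\mathcal X\times\mathcal Y)^N$ and works in rounds, with seeds $\zeta^{(1)},\zeta^{(2)},\dots,\zeta$ i.i.d. uniform on $[0,1]$ and independent of $\mathcal D_N$. In round $r\ge1$ it computes a data set of finite size and a seed, $(\mathcal D^{(r)},\xi^{(r)})$, as a function $g^{(r)}$ of $\mathcal D_N$,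 of $\zeta^{(r)}$ and of the data sets, fitted models and seeds of the previous rounds, and then the fitted models $\widehat f^{(r)}_l=\mathcal A_l(\mathcal D^{(r)};\xi^{(r)})$, $l=0,1$. After each round a criterion that depends on $\mathcal D_N$ and on everything in the rounds so far decides whether to stop. When it stops, $\widehat T(\mathcal A_0,\mathcal A_1,\mathcal D_N)\in\{0,1\}$ is a function $g$ of $\mathcal D_N$, of everything in the rounds so far, and of $\zeta$. For all $\mathcal A_0,\mathcal A_1$, the output is assumed to be a measurable function of $(\mathcal D_N,\zeta^{(1)},\zeta^{(2)},\dots,\zeta)$, and the number of rounds to be almost surely finite when $\mathcal D_N$ is i.i.d. from any $P$. Write $\mathbb P_P$ for the probability over $\mathcal D_N$ i.i.d. from $P$ and over the seeds. **Theorem.** Assume that $|\mathcal X|=\infty$ or $|\mathcal Y|=\infty$, and that $\psi$ takes values in $[-B,B]$. Let $\alpha\in(0,1)$, $n,N\ge1$, $q\in\{1,2\}$ and $\gamma_q\ge 4B/n^{1/q}$. Let $\widehat T$ be a black-box test such that \[\mathbb P_P\big(\widehat T(\mathcal A_0,\mathcal A_1,\mathcal D_N)=1\big)\le\alpha\quad\text{for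 all }\mathcal A_0,\mathcal A_1,P\text{ with }\beta_q(\mathcal A_0,\mathcal A_1,P,n)\le\gamma_q\text{ and }\Delta_{P,n}(\mathcal A_0,\mathcal A_1)\le0.\] Then for all $\mathcal A_0,\mathcal A_1,P$ with $\beta_q(\mathcal A_0,\mathcal A_1,P,n)\le\gamma_q$, $\Delta_{P,n}(\mathcal A_0,\mathcal A_1)>0$ and $\Delta_P^{\max}>\frac{B(\alpha^{-1}-1)}{N}$, \[\mathbb P_P\big(\widehat T(\mathcal A_0,\mathcal A_1,\mathcal D_N)=1\big)\le\left[\alpha\left(1+\frac{\Delta_{P,n}(\mathcal A_0,\mathcal A_1)+\frac{B(\alpha^{-1}-1)}{N}}{\Delta_P^{\max}-\frac{B(\alpha^{-1}-1)}{N}}\right)^{N/n}\right]\wedge 1.\] -/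

import Mathlib

open MeasureTheory
open scoped unitInterval

noncomputable section

namespace AlgComparison

variable {X Y V : Type*} [MeasurableSpace X] [MeasurableSpace Y] [MeasurableSpace V]

/-- A (possibly randomized) algorithm for data in `X × Y` with predictions in `V`: it maps a data set
of any finite size and a random seed in `[0,1]` to a fitted model `X → V`, jointly measurably in the
data points, the seed and the feature value, for every sample size `n`. -/
structure Algorithm (X Y V : Type*) [MeasurableSpace X] [MeasurableSpace Y]
    [MeasurableSpace V] where
  fit : List (X × Y) → I → X → V
  measurable_fit : ∀ n : ℕ,
    Measurable fun p : (Fin n → X × Y) × I × X => fit (List.ofFn p.1) p.2.1 p.2.2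

/-- The record of one round of a black-box procedure: the generated data set `𝒟⁽ʳ⁾`, the generated
seed `ξ⁽ʳ⁾`, the seed `ζ⁽ʳ⁾` of the procedure itself, and the two fitted models. -/
structure Round (X Y V : Type*) where
  data : List (X × Y)
  xi : I
  zeta : I
  model₀ : X → V
  model₁ : X → V

/-- The functions that specify a black-box procedure for two algorithms, on an initial data set of
size `N`. The list of rounds is the history so far, so that its length tells the index of the
current round.
* `query`: the next data set and seed, from the initial data, the history and the new seed `ζ⁽ʳ⁾`;
* `halt`: the criterion for stopping, evaluated after every round;
* `output`: the final output (`true` is `1`), from the initial data, the history and a last seed. -/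
structure Procedure (X Y V : Type*) (N : ℕ) where
  query : (Fin N → X × Y) → List (Round X Y V) → I → List (X × Y) × I
  halt : (Fin N → X × Y) → List (Round X Y V) → Prop
  output : (Fin N → X × Y) → List (Round X Y V) → I → Bool

namespace Procedure

variable {N : ℕ}

/-- The history after `r` rounds. -/
def history (T : Procedure X Y V N) (A₀ A₁ : Algorithm X Y V) (D : Fin N → X × Y) (ζ : ℕ → I) :
    ℕ → List (Round X Y V)
  | 0 => []
  | r + 1 =>
    let h := T.history A₀ A₁ D ζ r
    let q := T.query D h (ζ r)
    h ++ [{ data := q.1, xi := q.2, zeta := ζ r,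
            model₀ := A₀.fit q.1 q.2, model₁ := A₁.fit q.1 q.2 }]

/-- `r` is the total number of rounds: the first `r ≥ 1` at which the stopping criterion holds. -/
def IsTotalRounds (T : Procedure X Y V N) (A₀ A₁ : Algorithm X Y V) (D : Fin N → X × Y)
    (ζ : ℕ → I) (r : ℕ) : Prop :=
  1 ≤ r ∧ T.halt D (T.history A₀ A₁ D ζ r) ∧
    ∀ s, 1 ≤ s → s < r → ¬ T.halt D (T.history A₀ A₁ D ζ s)

/-- The event, in terms of the initial data, the seeds of the rounds and the last seed, that the
procedure halts and returns `1`. -/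
def rejection (T : Procedure X Y V N) (A₀ A₁ : Algorithm X Y V) :
    Set ((Fin N → X × Y) × (ℕ → I) × I) :=
  {ω | ∃ r, T.IsTotalRounds A₀ A₁ ω.1 ω.2.1 r ∧
    T.output ω.1 (T.history A₀ A₁ ω.1 ω.2.1 r) ω.2.2 = true}

end Procedure

/-- The joint law of `N` i.i.d. data points from `P` and of independent uniform seeds: a sequence of
seeds for the rounds and a last one. -/
def testLaw (P : Measure (X × Y)) [IsProbabilityMeasure P] (N : ℕ) :
    Measure ((Fin N → X × Y) × (ℕ → I) × I) :=
  (Measure.pi fun _ : Fin N => P).prod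
    ((Measure.infinitePi fun _ : ℕ => (volume : Measure I)).prod (volume : Measure I))

/-- A black-box test for the comparison of two algorithms: a procedure whose output is a measurable
function of the initial data and the seeds, and which stops after finitely many rounds, almost
surely, for all algorithms and all data distributions. -/
structure BlackBoxTest (X Y V : Type*) [MeasurableSpace X] [MeasurableSpace Y] [MeasurableSpace V]
    (N : ℕ) extends Procedure X Y V N where
  measurableSet_rejection : ∀ A₀ A₁ : Algorithm X Y V,
    MeasurableSet (toProcedure.rejection A₀ A₁)
  terminates : ∀ (A₀ A₁ : Algorithm X Y V) (P : Measure (X × Y)) [IsProbabilityMeasure P],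
    ∀ᵐ ω ∂(testLaw P N), ∃ r, toProcedure.IsTotalRounds A₀ A₁ ω.1 ω.2.1 r

/-- The probability, over data sampled i.i.d. from `P` and over the seeds, that the test run on
`A₀`, `A₁` returns `1`. -/
def BlackBoxTest.rejectProb {N : ℕ} (T : BlackBoxTest X Y V N) (A₀ A₁ : Algorithm X Y V)
    (P : Measure (X × Y)) [IsProbabilityMeasure P] : ℝ :=
  (testLaw P N).real (T.rejection A₀ A₁)

/-- The comparison risk `Δ_P(f₀, f₁) = 𝔼[ψ(f₀(X), f₁(X), Y)]` of two models. -/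
def modelRisk (ψ : V → V → Y → ℝ) (P : Measure (X × Y)) (f₀ f₁ : X → V) : ℝ :=
  ∫ z, ψ (f₀ z.1) (f₁ z.1) z.2 ∂P

/-- `Δ_P^max`, the supremum of `Δ_P(f₀, f₁)` over measurable functions `f₀, f₁`. -/
def maxRisk (ψ : V → V → Y → ℝ) (P : Measure (X × Y)) : ℝ :=
  sSup {d | ∃ f₀ f₁ : X → V, Measurable f₀ ∧ Measurable f₁ ∧ d = modelRisk ψ P f₀ f₁}

/-- The comparison risk `Δ_{P,n}(A₀, A₁)` of two algorithms, both run on the same `n` i.i.d. data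
points from `P` and with the same uniform seed. -/
def algRisk (ψ : V → V → Y → ℝ) (P : Measure (X × Y)) (n : ℕ) (A₀ A₁ : Algorithm X Y V) : ℝ :=
  ∫ ω : (Fin n → X × Y) × I,
    modelRisk ψ P (A₀.fit (List.ofFn ω.1) ω.2) (A₁.fit (List.ofFn ω.1) ω.2)
    ∂((Measure.pi fun _ : Fin n => P).prod volume)

/-- The `ℓ_q`-stability `β_q(A₀, A₁, P, n)` of a pair of algorithms with respect to `ψ`: the maximum
over `j` of the `L^q` norm of the change of `ψ` at an independent test point when the `j`-th
training point is removed. -/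
def stability (ψ : V → V → Y → ℝ) (q : ℕ) (P : Measure (X × Y)) (n : ℕ)
    (A₀ A₁ : Algorithm X Y V) : ℝ :=
  ⨆ j : Fin n,
    (∫ ω : (Fin n → X × Y) × (X × Y) × I,
      |ψ (A₀.fit (List.ofFn ω.1) ω.2.2 ω.2.1.1) (A₁.fit (List.ofFn ω.1) ω.2.2 ω.2.1.1) ω.2.1.2 -
        ψ (A₀.fit ((List.ofFn ω.1).eraseIdx j) ω.2.2 ω.2.1.1)
          (A₁.fit ((List.ofFn ω.1).eraseIdx j) ω.2.2 ω.2.1.1) ω.2.1.2| ^ q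
      ∂((Measure.pi fun _ : Fin n => P).prod (P.prod volume))) ^ (1 / (q : ℝ))

end AlgComparison

end

/-! The law and the algorithms are perturbed so that the null hypothesis holds, while the test can
hardly notice. Replace `P` by `P' = aP + (1-a)δ_z`, and let both algorithms return fixed models `g₁,
g₀` as soon as `z` is in their data. Here `g₀, g₁` nearly attain `Δ_P^max`; by antisymmetry of `ψ`,
exchanging them gives risk near `-Δ_P^max`.

If `P{z}` is negligible, a training sample from `P'` avoids `z` with probability about `a^n`, so the
new risk is at most about `a(a^n Δ - (1-a^n)Δ_P^max) + (1-a)B`. Stability survives because removing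
one point matters only if the sample avoids `z` or contains it exactly once
(`integral_lossChange_trigger_le`, `stability_bound_lt`).

A test that never queries a data set containing `z` runs identically on the old and new algorithms.
A terminating run queries finitely many points, so along distinct points `z k` the rejection
probability under `P` converges to the original one (`tendsto_real_rejection_trigger`). As `P'^N ≥
a^N P^N`, validity gives `a^N ℙ_P(T = 1) ≤ α` (`rejectProb_mul_pow_le`). It remains to choose `a`.
-/

noncomputable section

namespace AlgComparison

open Filter Topology

/-! ### Contamination of a law by a point mass. -/

section Contamination

variable {Z : Type*}

/-- The samples that do not contain `z`. -/
def avoiding (n : ℕ) (z : Z) : Set (Fin n → Z) := Set.univ.pi fun _ => {z}ᶜ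

theorem mem_avoiding {n : ℕ} {z : Z} {D : Fin n → Z} : D ∈ avoiding n z ↔ ∀ i, D i ≠ z := by
  simp [avoiding]

/-- The samples in which `z` is the value of the `j`-th point, and of no other. -/
def onlyAt (m : ℕ) (z : Z) (j : Fin (m + 1)) : Set (Fin (m + 1) → Z) :=
  Set.univ.pi fun i => if i = j then {z} else {z}ᶜ

theorem mem_onlyAt {m : ℕ} {z : Z} {j : Fin (m + 1)} {D : Fin (m + 1) → Z} :
    D ∈ onlyAt m z j ↔ D j = z ∧ ∀ i, D (j.succAbove i) ≠ z := by
  simp only [onlyAt, Set.mem_univ_pi]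
  rw [Fin.forall_iff_succAbove j]
  simp [Fin.succAbove_ne]

variable {W : Type*} [MeasurableSpace Z] [MeasurableSpace W]

/-- A measure on a finite product that is bounded on boxes by a product of measures is bounded by
the product measure. -/
theorem le_pi_of_forall_box_le {n : ℕ} (ν : Measure (Fin n → Z)) (μ : Measure Z)
    (h : ∀ s : Fin n → Set Z, ν (Set.univ.pi s) ≤ ∏ i, μ (s i)) :
    ν ≤ Measure.pi fun _ => μ := by
  -- The product outer measure is the largest one bounded by the product on boxes.
  have h₁ : ν.toOuterMeasure ≤ OuterMeasure.pi fun _ => μ.toOuterMeasure := by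
    rw [OuterMeasure.le_pi]
    intro s _
    exact h s
  intro s
  calc ν s ≤ (OuterMeasure.pi fun _ : Fin n => μ.toOuterMeasure) s := h₁ s
    _ ≤ _ := by
      rw [Measure.pi]
      exact le_toMeasure_apply _ _ _

theorem pi_const_smul (n : ℕ) (c : ENNReal) (hc : c ≠ ⊤) (P : Measure Z) [IsFiniteMeasure P] :
    (Measure.pi fun _ : Fin n => c • P) = c ^ n • Measure.pi fun _ : Fin n => P := by
  have : IsFiniteMeasure (c • P) := P.smul_finite hc
  refine Measure.pi_eq fun s _ => ?_
  simp [Measure.pi_pi, Finset.prod_mul_distrib]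

/-- The mixture of `P`, with weight `a`, and of the point mass at `z`. -/
def contaminated (P : Measure Z) (z : Z) (a : ℝ) : Measure Z :=
  ENNReal.ofReal a • P + ENNReal.ofReal (1 - a) • Measure.dirac z

theorem isProbabilityMeasure_contaminated (P : Measure Z) [IsProbabilityMeasure P] (z : Z) {a : ℝ}
    (ha : a ∈ Set.Ioo (0 : ℝ) 1) : IsProbabilityMeasure (contaminated P z a) := by
  constructor
  have h0 := ha.1.le
  have h1 : 0 ≤ 1 - a := by linarith [ha.2]
  simp [contaminated, ← ENNReal.ofReal_add h0 h1]

theorem contaminated_real_singleton [MeasurableSingletonClass Z] (P : Measure Z)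
    [IsProbabilityMeasure P] (z : Z) {a : ℝ} (ha : a ∈ Set.Ioo (0 : ℝ) 1) :
    (contaminated P z a).real {z} = a * P.real {z} + (1 - a) := by
  have h0 := ha.1.le
  have h1 : 0 ≤ 1 - a := by linarith [ha.2]
  rw [Measure.real, contaminated, Measure.add_apply, Measure.smul_apply, Measure.smul_apply,
    smul_eq_mul, smul_eq_mul, ENNReal.toReal_add (by finiteness) (by finiteness)]
  simp [h0, h1, Measure.real]

theorem contaminated_real_compl_singleton [MeasurableSingletonClass Z] (P : Measure Z)
    [IsProbabilityMeasure P] (z : Z) {a : ℝ} (ha : a ∈ Set.Ioo (0 : ℝ) 1) :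
    (contaminated P z a).real {z}ᶜ = a * (1 - P.real {z}) := by
  have := isProbabilityMeasure_contaminated P z ha
  rw [probReal_compl_eq_one_sub (measurableSet_singleton z), contaminated_real_singleton P z ha]
  ring

theorem integral_contaminated [MeasurableSingletonClass Z] (P : Measure Z) [IsFiniteMeasure P]
    (z : Z) {a : ℝ} (ha : a ∈ Set.Ioo (0 : ℝ) 1) {f : Z → ℝ} (hf : Integrable f P) :
    ∫ x, f x ∂(contaminated P z a) = a * ∫ x, f x ∂P + (1 - a) * f z := by
  have h0 := ha.1.le
  have h1 : 0 ≤ 1 - a := by linarith [ha.2]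
  have hd : Integrable f (Measure.dirac z) := integrable_dirac (by finiteness)
  rw [contaminated, integral_add_measure (hf.smul_measure (by finiteness))
    (hd.smul_measure (by finiteness)), integral_smul_measure, integral_smul_measure,
    integral_dirac]
  simp [h0, h1]

/-- The left side is the part of the mixture in which every point is drawn from `P`. -/
theorem smul_pi_le_pi_contaminated (n : ℕ) (P : Measure Z) [IsProbabilityMeasure P] (z : Z)
    (a : ℝ) :
    (ENNReal.ofReal a ^ n • Measure.pi fun _ : Fin n => P) ≤
      Measure.pi fun _ : Fin n => contaminated P z a := by
  refine le_pi_of_forall_box_le _ _ fun s => ?_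
  simp only [Measure.smul_apply, Measure.pi_pi, smul_eq_mul]
  calc _ = ∏ i, ENNReal.ofReal a * P (s i) := by simp [Finset.prod_mul_distrib]
    _ ≤ _ := Finset.prod_le_prod' fun i _ => by
      simp [contaminated]

theorem measurableSet_avoiding [MeasurableSingletonClass Z] (n : ℕ) (z : Z) :
    MeasurableSet (avoiding n z) :=
  MeasurableSet.univ_pi fun _ => (measurableSet_singleton z).compl

/-- Away from `z` only the `P` component has mass. Equality can fail because `P` may charge `z`. -/
theorem restrict_pi_contaminated_le [MeasurableSingletonClass Z] (n : ℕ) (P : Measure Z)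
    [IsProbabilityMeasure P] (z : Z) {a : ℝ} (ha : a ∈ Set.Ioo (0 : ℝ) 1) :
    (Measure.pi fun _ : Fin n => contaminated P z a).restrict (avoiding n z) ≤
      ENNReal.ofReal a ^ n • Measure.pi fun _ : Fin n => P := by
  have := isProbabilityMeasure_contaminated P z ha
  rw [← pi_const_smul n _ ENNReal.ofReal_ne_top]
  refine le_pi_of_forall_box_le _ _ fun s => ?_
  rw [Measure.restrict_apply' (measurableSet_avoiding n z), avoiding, ← Set.pi_inter_distrib,
    Measure.pi_pi]
  refine Finset.prod_le_prod' fun i _ => ?_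
  change contaminated P z a (s i ∩ {z}ᶜ) ≤ _
  have h₁ : Measure.dirac z (s i ∩ {z}ᶜ) = 0 :=
    measure_mono_null Set.inter_subset_right
      (by simp [Measure.dirac_apply' _ (measurableSet_singleton z).compl])
  simp only [contaminated, Measure.add_apply, Measure.smul_apply, h₁, mul_zero, add_zero,
    smul_eq_mul]
  gcongr
  exact Set.inter_subset_left

theorem pi_contaminated_real_avoiding [MeasurableSingletonClass Z] (n : ℕ) (P : Measure Z)
    [IsProbabilityMeasure P] (z : Z) {a : ℝ} (ha : a ∈ Set.Ioo (0 : ℝ) 1) :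
    (Measure.pi fun _ : Fin n => contaminated P z a).real (avoiding n z) =
      (a * (1 - P.real {z})) ^ n := by
  have := isProbabilityMeasure_contaminated P z ha
  rw [avoiding, Measure.real, Measure.pi_pi, ENNReal.toReal_prod,
    ← contaminated_real_compl_singleton P z ha]
  simp [Measure.real]

theorem measurableSet_onlyAt [MeasurableSingletonClass Z] (m : ℕ) (z : Z) (j : Fin (m + 1)) :
    MeasurableSet (onlyAt m z j) :=
  MeasurableSet.univ_pi fun i => by
    split_ifs
    exacts [measurableSet_singleton z, (measurableSet_singleton z).compl]

theorem pi_contaminated_real_onlyAt [MeasurableSingletonClass Z] (m : ℕ) (P : Measure Z)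
    [IsProbabilityMeasure P] (z : Z) {a : ℝ} (ha : a ∈ Set.Ioo (0 : ℝ) 1) (j : Fin (m + 1)) :
    (Measure.pi fun _ : Fin (m + 1) => contaminated P z a).real (onlyAt m z j) =
      (a * P.real {z} + (1 - a)) * (a * (1 - P.real {z})) ^ m := by
  have := isProbabilityMeasure_contaminated P z ha
  rw [onlyAt, Measure.real, Measure.pi_pi, ENNReal.toReal_prod, Fin.prod_univ_succAbove _ j,
    ← contaminated_real_compl_singleton P z ha, ← contaminated_real_singleton P z ha]
  simp [Fin.succAbove_ne, Measure.real]

theorem integrable_of_mem_Icc {μ : Measure Z} [IsFiniteMeasure μ] {f : Z → ℝ} (hf : Measurable f)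
    {l u : ℝ} (h : ∀ x, f x ∈ Set.Icc l u) : Integrable f μ :=
  .of_mem_Icc l u hf.aemeasurable (.of_forall h)

theorem setIntegral_avoiding_le [MeasurableSingletonClass Z] (n : ℕ) (P : Measure Z)
    [IsProbabilityMeasure P] (z : Z) {a : ℝ} (ha : a ∈ Set.Ioo (0 : ℝ) 1) (ν : Measure W)
    [IsProbabilityMeasure ν] {h : (Fin n → Z) × W → ℝ} (hm : Measurable h) {K : ℝ}
    (hK : ∀ x, h x ∈ Set.Icc 0 K) :
    ∫ ω in avoiding n z ×ˢ Set.univ, h ω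
        ∂((Measure.pi fun _ : Fin n => contaminated P z a).prod ν) ≤
      a ^ n * ∫ ω, h ω ∂((Measure.pi fun _ : Fin n => P).prod ν) := by
  have := isProbabilityMeasure_contaminated P z ha
  have hle := Measure.prod_mono (restrict_pi_contaminated_le n P z ha) (le_refl ν)
  rw [Measure.prod_smul_left] at hle
  have hint : Integrable h ((Measure.pi fun _ : Fin n => P).prod ν) := integrable_of_mem_Icc hm hK
  have := integral_mono_measure hle (.of_forall fun x => (hK x).1)
    (hint.smul_measure (by finiteness))
  rw [integral_smul_measure, Measure.restrict_prod_eq_prod_univ] at this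
  simpa [ha.1.le] using this

theorem integral_prod_contaminated_le [MeasurableSingletonClass Z] {U : Type*} [MeasurableSpace U]
    (μ : Measure U) [IsProbabilityMeasure μ] (P : Measure Z)
    [IsProbabilityMeasure P] (z : Z) {a : ℝ} (ha : a ∈ Set.Ioo (0 : ℝ) 1) (ν : Measure W)
    [IsProbabilityMeasure ν] {h : U × Z × W → ℝ} (hm : Measurable h) {K : ℝ}
    (hK : ∀ x, h x ∈ Set.Icc 0 K) :
    ∫ ω, h ω ∂(μ.prod ((contaminated P z a).prod ν)) ≤
      a * ∫ ω, h ω ∂(μ.prod (P.prod ν)) + (1 - a) * K := by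
  have h0 := ha.1.le
  have h1 : 0 ≤ 1 - a := by linarith [ha.2]
  have key : μ.prod ((contaminated P z a).prod ν) = ENNReal.ofReal a • μ.prod (P.prod ν) +
      ENNReal.ofReal (1 - a) • μ.prod ((Measure.dirac z).prod ν) := by
    rw [contaminated, Measure.add_prod, Measure.prod_add, Measure.prod_smul_left,
      Measure.prod_smul_left, Measure.prod_smul_right, Measure.prod_smul_right]
  have i1 : Integrable h (μ.prod (P.prod ν)) := integrable_of_mem_Icc hm hK
  have i2 : Integrable h (μ.prod ((Measure.dirac z).prod ν)) := integrable_of_mem_Icc hm hK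
  have h2 : ∫ ω, h ω ∂(μ.prod ((Measure.dirac z).prod ν)) ≤ K := by
    calc _ ≤ ∫ _, K ∂(μ.prod ((Measure.dirac z).prod ν)) :=
          integral_mono i2 (integrable_const _) fun x => (hK x).2
      _ = K := by simp
  rw [key, integral_add_measure (i1.smul_measure (by finiteness)) (i2.smul_measure (by finiteness)),
    integral_smul_measure, integral_smul_measure, ENNReal.toReal_ofReal h0,
    ENNReal.toReal_ofReal h1, smul_eq_mul, smul_eq_mul]
  gcongr

/-- Distinct singletons are disjoint, so their masses are summable. This handles laws `P` with
atoms, for which no single `z` need be null. -/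
theorem tendsto_measureReal_singleton [MeasurableSingletonClass Z] (P : Measure Z)
    [IsProbabilityMeasure P] {z : ℕ → Z} (hz : Function.Injective z) :
    Tendsto (fun k => P.real {z k}) atTop (𝓝 0) := by
  have hsum : ∑' k, P {z k} ≠ ⊤ := by
    rw [← measure_iUnion (fun i j hij => by simpa using hz.ne hij)
      fun k => measurableSet_singleton _]
    finiteness
  exact (ENNReal.tendsto_toReal ENNReal.zero_ne_top).comp
    (ENNReal.tendsto_atTop_zero_of_tsum_ne_top hsum)

end Contamination

/-! ### Algorithms with a trigger point: stability and risk. -/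

section Trigger

variable {X Y V : Type*} [MeasurableSpace X] [MeasurableSpace Y] [MeasurableSpace V]

open Classical in
/-- The algorithm that returns the model `g` if the data contain `z`, and runs `A` otherwise. -/
def Algorithm.trigger [MeasurableSingletonClass X] [MeasurableSingletonClass Y]
    (A : Algorithm X Y V) (z : X × Y) (g : X → V) (hg : Measurable g) : Algorithm X Y V where
  fit D ξ := if z ∈ D then g else A.fit D ξ
  measurable_fit n := by
    have hs : MeasurableSet {p : (Fin n → X × Y) × I × X | z ∈ List.ofFn p.1} := by
      have : {p : (Fin n → X × Y) × I × X | z ∈ List.ofFn p.1} =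
          ⋃ i, (fun p : (Fin n → X × Y) × I × X => p.1 i) ⁻¹' {z} := by
        ext p
        simp [List.mem_ofFn]
      rw [this]
      exact MeasurableSet.iUnion fun i =>
        ((measurable_pi_apply i).comp measurable_fst) (measurableSet_singleton z)
    have h := @Measurable.piecewise _ _ _ _ _ _ _ (Classical.decPred _) hs
      (hg.comp (measurable_snd.comp measurable_snd)) (A.measurable_fit n)
    refine (congrArg Measurable (funext fun p => ?_)).mp h
    simp only [Set.piecewise, Set.mem_ofPred_eq]
    split_ifs <;> rfl

section

variable [MeasurableSingletonClass X] [MeasurableSingletonClass Y] (A : Algorithm X Y V)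
  {z : X × Y} {g : X → V} (hg : Measurable g) {D : List (X × Y)} (ξ : I)

theorem Algorithm.trigger_fit_of_mem (h : z ∈ D) : (A.trigger z g hg).fit D ξ = g := by
  simp [Algorithm.trigger, h]

theorem Algorithm.trigger_fit_of_notMem (h : z ∉ D) :
    (A.trigger z g hg).fit D ξ = A.fit D ξ := by
  simp [Algorithm.trigger, h]

end

theorem ofFn_eraseIdx {Z : Type*} {m : ℕ} (D : Fin (m + 1) → Z) (j : Fin (m + 1)) :
    (List.ofFn D).eraseIdx j = List.ofFn fun i => D (j.succAbove i) := by
  refine List.ext_getElem ?_ fun i h₁ h₂ => ?_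
  · simp [List.length_eraseIdx, Nat.lt_succ_iff.1 j.2]
  · rw [List.getElem_eraseIdx]
    simp only [List.getElem_ofFn, Fin.succAbove, Fin.lt_def, Fin.val_castSucc]
    split_ifs <;> rfl

/-- The value of `ψ` for the models fitted to a list of data, at a test point. -/
def lossAt (ψ : V → V → Y → ℝ) (A₀ A₁ : Algorithm X Y V) (D : List (X × Y)) (z : X × Y) (ξ : I) :
    ℝ :=
  ψ (A₀.fit D ξ z.1) (A₁.fit D ξ z.1) z.2

/-- The change of `ψ` at a test point when the `j`-th data point is removed. -/
def lossChange (ψ : V → V → Y → ℝ) (A₀ A₁ : Algorithm X Y V) {n : ℕ} (j : Fin n)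
    (ω : (Fin n → X × Y) × (X × Y) × I) : ℝ :=
  |lossAt ψ A₀ A₁ (List.ofFn ω.1) ω.2.1 ω.2.2 -
    lossAt ψ A₀ A₁ ((List.ofFn ω.1).eraseIdx j) ω.2.1 ω.2.2|

variable {ψ : V → V → Y → ℝ}

theorem measurable_lossAt (hψ : Measurable fun p : V × V × Y => ψ p.1 p.2.1 p.2.2)
    (A₀ A₁ : Algorithm X Y V) (n : ℕ) :
    Measurable fun ω : (Fin n → X × Y) × (X × Y) × I =>
      lossAt ψ A₀ A₁ (List.ofFn ω.1) ω.2.1 ω.2.2 := by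
  have hfit (A : Algorithm X Y V) : Measurable fun ω : (Fin n → X × Y) × (X × Y) × I =>
      A.fit (List.ofFn ω.1) ω.2.2 ω.2.1.1 :=
    (A.measurable_fit n).comp (g := fun p : (Fin n → X × Y) × I × X => _)
      (f := fun ω : (Fin n → X × Y) × (X × Y) × I => (ω.1, ω.2.2, ω.2.1.1)) (by fun_prop)
  exact hψ.comp (g := fun p : V × V × Y => _)
    ((hfit A₀).prodMk ((hfit A₁).prodMk (by fun_prop : Measurable
      fun ω : (Fin n → X × Y) × (X × Y) × I => ω.2.1.2)))

theorem measurable_lossChange (hψ : Measurable fun p : V × V × Y => ψ p.1 p.2.1 p.2.2)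
    (A₀ A₁ : Algorithm X Y V) {m : ℕ} (j : Fin (m + 1)) :
    Measurable (lossChange ψ A₀ A₁ j) := by
  unfold lossChange
  simp only [ofFn_eraseIdx]
  have h₂ := (measurable_lossAt hψ A₀ A₁ m).comp
    (f := fun ω : (Fin (m + 1) → X × Y) × (X × Y) × I => (fun i => ω.1 (j.succAbove i), ω.2))
    (by fun_prop)
  exact ((measurable_lossAt hψ A₀ A₁ (m + 1)).sub h₂).abs

theorem measurable_modelRisk (hψ : Measurable fun p : V × V × Y => ψ p.1 p.2.1 p.2.2)
    (P : Measure (X × Y)) [SFinite P] (A₀ A₁ : Algorithm X Y V) (n : ℕ) :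
    Measurable fun ω : (Fin n → X × Y) × I =>
      modelRisk ψ P (A₀.fit (List.ofFn ω.1) ω.2) (A₁.fit (List.ofFn ω.1) ω.2) := by
  have h := (measurable_lossAt hψ A₀ A₁ n).comp
    (f := fun p : ((Fin n → X × Y) × I) × (X × Y) => (p.1.1, p.2, p.1.2)) (by fun_prop)
  exact (StronglyMeasurable.integral_prod_right (ν := P) (f := fun (ω : (Fin n → X × Y) × I) z =>
    lossAt ψ A₀ A₁ (List.ofFn ω.1) z ω.2) h.stronglyMeasurable).measurable

theorem measurable_fit_section (A : Algorithm X Y V) {n : ℕ} (D : Fin n → X × Y) (ξ : I) :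
    Measurable (A.fit (List.ofFn D) ξ) :=
  (A.measurable_fit n).comp (g := fun p : (Fin n → X × Y) × I × X => _)
      (f := fun x : X => (D, ξ, x)) (by fun_prop)

theorem integrable_loss (hψ : Measurable fun p : V × V × Y => ψ p.1 p.2.1 p.2.2) {B : ℝ}
    (hB : ∀ v v' y, ψ v v' y ∈ Set.Icc (-B) B) (P : Measure (X × Y)) [IsFiniteMeasure P]
    {f₀ f₁ : X → V} (h₀ : Measurable f₀) (h₁ : Measurable f₁) :
    Integrable (fun z => ψ (f₀ z.1) (f₁ z.1) z.2) P :=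
  integrable_of_mem_Icc (hψ.comp (g := fun p : V × V × Y => _)
    (f := fun z : X × Y => (f₀ z.1, f₁ z.1, z.2)) (by fun_prop)) fun _ => hB _ _ _

theorem modelRisk_mem_Icc (hψ : Measurable fun p : V × V × Y => ψ p.1 p.2.1 p.2.2) {B : ℝ}
    (hB : ∀ v v' y, ψ v v' y ∈ Set.Icc (-B) B) (P : Measure (X × Y)) [IsProbabilityMeasure P]
    {f₀ f₁ : X → V} (h₀ : Measurable f₀) (h₁ : Measurable f₁) :
    modelRisk ψ P f₀ f₁ ∈ Set.Icc (-B) B := by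
  have hi := integrable_loss hψ hB P h₀ h₁
  constructor
  · simpa [modelRisk] using integral_mono (integrable_const (-B)) hi fun z => (hB _ _ _).1
  · simpa [modelRisk] using integral_mono hi (integrable_const B) fun z => (hB _ _ _).2

theorem lossChange_mem_Icc {B : ℝ} (hB : ∀ v v' y, ψ v v' y ∈ Set.Icc (-B) B)
    (A₀ A₁ : Algorithm X Y V) {n : ℕ} (j : Fin n) (ω : (Fin n → X × Y) × (X × Y) × I) :
    lossChange ψ A₀ A₁ j ω ∈ Set.Icc 0 (2 * B) := by
  refine ⟨abs_nonneg _, ?_⟩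
  have h₁ := abs_le.2 (hB (A₀.fit (List.ofFn ω.1) ω.2.2 ω.2.1.1)
    (A₁.fit (List.ofFn ω.1) ω.2.2 ω.2.1.1) ω.2.1.2)
  have h₂ := abs_le.2 (hB (A₀.fit ((List.ofFn ω.1).eraseIdx j) ω.2.2 ω.2.1.1)
    (A₁.fit ((List.ofFn ω.1).eraseIdx j) ω.2.2 ω.2.1.1) ω.2.1.2)
  calc _ ≤ _ := abs_sub _ _
    _ ≤ B + B := add_le_add h₁ h₂
    _ = _ := by ring

/-- Without the root and the maximum, stability is a bound on integrals, which are affine in the law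
of the test point. -/
theorem stability_le_iff {q : ℕ} (hq : q ≠ 0) {γ : ℝ} (hγ : 0 ≤ γ) (P : Measure (X × Y))
    {n : ℕ} (hn : n ≠ 0) (A₀ A₁ : Algorithm X Y V) :
    stability ψ q P n A₀ A₁ ≤ γ ↔ ∀ j : Fin n, ∫ ω, lossChange ψ A₀ A₁ j ω ^ q
      ∂((Measure.pi fun _ : Fin n => P).prod (P.prod volume)) ≤ γ ^ q := by
  have : Nonempty (Fin n) := ⟨⟨0, Nat.pos_of_ne_zero hn⟩⟩
  change (⨆ j : Fin n, (∫ ω, lossChange ψ A₀ A₁ j ω ^ q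
      ∂((Measure.pi fun _ : Fin n => P).prod (P.prod volume))) ^ (1 / (q : ℝ))) ≤ γ ↔ _
  rw [ciSup_le_iff (Set.finite_range _).bddAbove]
  refine forall_congr' fun j => ?_
  have h0 : 0 ≤ ∫ ω, lossChange ψ A₀ A₁ j ω ^ q
      ∂((Measure.pi fun _ : Fin n => P).prod (P.prod volume)) :=
    integral_nonneg fun _ => pow_nonneg (abs_nonneg _) _
  rw [one_div, Real.rpow_inv_le_iff_of_pos h0 hγ (by positivity), Real.rpow_natCast]

variable [MeasurableSingletonClass X] [MeasurableSingletonClass Y]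

/-- If `z` remains after removal, both fits return the fixed models and nothing changes. If `z` was
absent, the change is the original one. Otherwise `z` was the `j`-th point only, and the trivial
bound `2B` applies. -/
theorem lossChange_trigger_pow_le {B : ℝ} (hB : ∀ v v' y, ψ v v' y ∈ Set.Icc (-B) B)
    (A₀ A₁ : Algorithm X Y V) (z : X × Y) {g₀ g₁ : X → V} (h₀ : Measurable g₀)
    (h₁ : Measurable g₁) {m : ℕ} (j : Fin (m + 1)) {q : ℕ} (hq : q ≠ 0)
    (ω : (Fin (m + 1) → X × Y) × (X × Y) × I) :
    lossChange ψ (A₀.trigger z g₀ h₀) (A₁.trigger z g₁ h₁) j ω ^ q ≤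
      (avoiding (m + 1) z ×ˢ Set.univ).indicator (fun ω => lossChange ψ A₀ A₁ j ω ^ q) ω +
      (onlyAt m z j ×ˢ Set.univ).indicator (fun _ => (2 * B) ^ q) ω := by
  have hn : 0 ≤ (avoiding (m + 1) z ×ˢ Set.univ).indicator
      (fun ω => lossChange ψ A₀ A₁ j ω ^ q) ω :=
    Set.indicator_nonneg (fun _ _ => pow_nonneg (abs_nonneg _) _) _
  have hc := lossChange_mem_Icc hB (A₀.trigger z g₀ h₀) (A₁.trigger z g₁ h₁) j ω
  have hn' : 0 ≤ (onlyAt m z j ×ˢ Set.univ).indicator (fun _ => (2 * B) ^ q) ω :=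
    Set.indicator_nonneg (fun _ _ => pow_nonneg (hc.1.trans hc.2) _) _
  by_cases hz : z ∈ List.ofFn ω.1
  · by_cases he : z ∈ (List.ofFn ω.1).eraseIdx j
    · have : lossChange ψ (A₀.trigger z g₀ h₀) (A₁.trigger z g₁ h₁) j ω = 0 := by
        simp only [lossChange, lossAt, Algorithm.trigger_fit_of_mem, hz, he, sub_self, abs_zero]
      rw [this, zero_pow hq]
      positivity
    · have hmem : ω ∈ onlyAt m z j ×ˢ Set.univ := by
        refine ⟨mem_onlyAt.2 ?_, trivial⟩
        rw [ofFn_eraseIdx, List.mem_ofFn, not_exists] at he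
        refine ⟨?_, he⟩
        obtain ⟨i, hi⟩ := List.mem_ofFn.1 hz
        by_contra hj
        obtain ⟨i', rfl⟩ := Fin.exists_succAbove_eq (x := i) (y := j) (fun h => hj (h ▸ hi))
        exact he i' hi
      rw [Set.indicator_of_mem hmem]
      linarith [pow_le_pow_left₀ hc.1 hc.2 q]
  · have he : z ∉ (List.ofFn ω.1).eraseIdx j := fun h => hz (List.mem_of_mem_eraseIdx h)
    have hmem : ω ∈ avoiding (m + 1) z ×ˢ (Set.univ : Set ((X × Y) × I)) :=
      ⟨mem_avoiding.2 fun i hi => hz (List.mem_ofFn.2 ⟨i, hi⟩), trivial⟩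
    have : lossChange ψ (A₀.trigger z g₀ h₀) (A₁.trigger z g₁ h₁) j ω =
        lossChange ψ A₀ A₁ j ω := by
      simp only [lossChange, lossAt, Algorithm.trigger_fit_of_notMem, hz, he, not_false_eq_true]
    rw [Set.indicator_of_mem hmem, this]
    linarith

theorem integral_lossChange_trigger_le (hψ : Measurable fun p : V × V × Y => ψ p.1 p.2.1 p.2.2)
    {B : ℝ} (hB : ∀ v v' y, ψ v v' y ∈ Set.Icc (-B) B)
    (A₀ A₁ : Algorithm X Y V) (P : Measure (X × Y)) [IsProbabilityMeasure P] (z : X × Y)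
    {a : ℝ} (ha : a ∈ Set.Ioo (0 : ℝ) 1) {g₀ g₁ : X → V} (h₀ : Measurable g₀)
    (h₁ : Measurable g₁) {m : ℕ} (j : Fin (m + 1)) {q : ℕ} (hq : q ≠ 0) :
    ∫ ω, lossChange ψ (A₀.trigger z g₀ h₀) (A₁.trigger z g₁ h₁) j ω ^ q
        ∂((Measure.pi fun _ : Fin (m + 1) => contaminated P z a).prod
          ((contaminated P z a).prod volume)) ≤
      a ^ (m + 1) * (a * ∫ ω, lossChange ψ A₀ A₁ j ω ^ q
        ∂((Measure.pi fun _ : Fin (m + 1) => P).prod (P.prod volume)) + (1 - a) * (2 * B) ^ q) +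
      (a * P.real {z} + (1 - a)) * (a * (1 - P.real {z})) ^ m * (2 * B) ^ q := by
  have := isProbabilityMeasure_contaminated P z ha
  have hm := (measurable_lossChange hψ A₀ A₁ j).pow_const q
  have hK : ∀ ω, lossChange ψ A₀ A₁ j ω ^ q ∈ Set.Icc 0 ((2 * B) ^ q) := fun ω =>
    have h := lossChange_mem_Icc hB A₀ A₁ j ω
    ⟨pow_nonneg h.1 _, pow_le_pow_left₀ h.1 h.2 q⟩
  have hE : MeasurableSet (avoiding (m + 1) z ×ˢ (Set.univ : Set ((X × Y) × I))) :=
    (measurableSet_avoiding _ _).prod .univ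
  have hF : MeasurableSet (onlyAt m z j ×ˢ (Set.univ : Set ((X × Y) × I))) :=
    (measurableSet_onlyAt _ _ _).prod .univ
  set μ := (Measure.pi fun _ : Fin (m + 1) => contaminated P z a).prod
    ((contaminated P z a).prod (volume : Measure I)) with hμ
  have i₁ : Integrable ((avoiding (m + 1) z ×ˢ Set.univ).indicator
      (fun ω => lossChange ψ A₀ A₁ j ω ^ q)) μ := (integrable_of_mem_Icc hm hK).indicator hE
  have i₂ : Integrable ((onlyAt m z j ×ˢ Set.univ).indicator (fun _ => (2 * B) ^ q)) μ :=
    (integrable_const _).indicator hF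
  calc _ ≤ ∫ ω, _ ∂μ := integral_mono
        (integrable_of_mem_Icc ((measurable_lossChange hψ _ _ j).pow_const q) fun ω =>
          have h := lossChange_mem_Icc hB (A₀.trigger z g₀ h₀) (A₁.trigger z g₁ h₁) j ω
          ⟨pow_nonneg h.1 _, pow_le_pow_left₀ h.1 h.2 q⟩)
        (i₁.add i₂) (lossChange_trigger_pow_le hB A₀ A₁ z h₀ h₁ j hq)
    _ = _ := integral_add i₁ i₂
    _ ≤ _ := by
      rw [integral_indicator hE, integral_indicator_const _ hF, smul_eq_mul]
      refine add_le_add ?_ (le_of_eq ?_)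
      · refine (setIntegral_avoiding_le (m + 1) P z ha _ hm hK).trans ?_
        exact mul_le_mul_of_nonneg_left (integral_prod_contaminated_le _ P z ha _ hm hK)
          (pow_nonneg ha.1.le _)
      · rw [← pi_contaminated_real_onlyAt m P z ha j, hμ, measureReal_prod_prod]
        simp

theorem modelRisk_contaminated (hψ : Measurable fun p : V × V × Y => ψ p.1 p.2.1 p.2.2)
    {B : ℝ} (hB : ∀ v v' y, ψ v v' y ∈ Set.Icc (-B) B) (P : Measure (X × Y))
    [IsProbabilityMeasure P] (z : X × Y) {a : ℝ} (ha : a ∈ Set.Ioo (0 : ℝ) 1) {f₀ f₁ : X → V}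
    (h₀ : Measurable f₀) (h₁ : Measurable f₁) :
    modelRisk ψ (contaminated P z a) f₀ f₁ ≤ a * modelRisk ψ P f₀ f₁ + (1 - a) * B := by
  rw [modelRisk, integral_contaminated P z ha (integrable_loss hψ hB P h₀ h₁)]
  have := mul_le_mul_of_nonneg_left (hB (f₀ z.1) (f₁ z.1) z.2).2 (sub_nonneg.2 ha.2.le)
  exact add_le_add le_rfl this

/-- The training sample either avoids `z`, and the original algorithms run, or it contains `z`, and
`g₀, g₁` are returned. In both cases the test point is `z` by contamination with weight `1 - a`, at
a cost of at most `B`. -/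
theorem algRisk_trigger_le (hψ : Measurable fun p : V × V × Y => ψ p.1 p.2.1 p.2.2)
    {B : ℝ} (hB : ∀ v v' y, ψ v v' y ∈ Set.Icc (-B) B)
    (A₀ A₁ : Algorithm X Y V) (P : Measure (X × Y)) [IsProbabilityMeasure P] (z : X × Y)
    {a : ℝ} (ha : a ∈ Set.Ioo (0 : ℝ) 1) {g₀ g₁ : X → V} (h₀ : Measurable g₀)
    (h₁ : Measurable g₁) (n : ℕ) :
    algRisk ψ (contaminated P z a) n (A₀.trigger z g₀ h₀) (A₁.trigger z g₁ h₁) ≤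
      a ^ n * (a * algRisk ψ P n A₀ A₁ + (1 - a) * B + B) - B * (a * (1 - P.real {z})) ^ n +
      (1 - (a * (1 - P.real {z})) ^ n) * (a * modelRisk ψ P g₀ g₁ + (1 - a) * B) := by
  have := isProbabilityMeasure_contaminated P z ha
  set P' := contaminated P z a
  set μ := (Measure.pi fun _ : Fin n => P').prod (volume : Measure I) with hμ
  set E : Set ((Fin n → X × Y) × I) := avoiding n z ×ˢ Set.univ with hEdef
  have hE : MeasurableSet E := (measurableSet_avoiding _ _).prod .univ
  have hμE : μ.real E = (a * (1 - P.real {z})) ^ n := by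
    rw [hμ, hEdef, measureReal_prod_prod, pi_contaminated_real_avoiding n P z ha]
    simp
  set G : (Fin n → X × Y) × I → ℝ := fun ω =>
    modelRisk ψ P' (A₀.fit (List.ofFn ω.1) ω.2) (A₁.fit (List.ofFn ω.1) ω.2)
  have hG : Measurable G := measurable_modelRisk hψ P' A₀ A₁ n
  have hGB : ∀ ω, G ω ∈ Set.Icc (-B) B := fun ω =>
    modelRisk_mem_Icc hψ hB P' (measurable_fit_section _ _ _) (measurable_fit_section _ _ _)
  have hG' : ∀ ω, G ω + B ∈ Set.Icc 0 (2 * B) := fun ω =>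
    ⟨by linarith [(hGB ω).1], by linarith [(hGB ω).2]⟩
  have hsplit : algRisk ψ P' n (A₀.trigger z g₀ h₀) (A₁.trigger z g₁ h₁) =
      ∫ ω in E, G ω ∂μ + ∫ ω in Eᶜ, modelRisk ψ P' g₀ g₁ ∂μ := by
    rw [algRisk, ← integral_add_compl hE (integrable_of_mem_Icc
      (measurable_modelRisk hψ P' _ _ n) fun ω => modelRisk_mem_Icc hψ hB P'
        (measurable_fit_section _ _ _) (measurable_fit_section _ _ _))]
    congr 1
    · refine setIntegral_congr_fun hE fun ω hω => ?_
      have hz : z ∉ List.ofFn ω.1 := by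
        simpa [List.mem_ofFn] using mem_avoiding.1 hω.1
      simp [G, Algorithm.trigger_fit_of_notMem, hz]
    · refine setIntegral_congr_fun hE.compl fun ω hω => ?_
      have hz : z ∈ List.ofFn ω.1 := by
        by_contra hz
        refine hω ⟨mem_avoiding.2 ?_, trivial⟩
        simpa [List.mem_ofFn] using hz
      simp [Algorithm.trigger_fit_of_mem, hz]
  -- The comparison of laws on `E` is one-sided, so it needs a nonnegative integrand: `G` is shifted
  -- by `B` and the shift subtracted afterwards.
  have h₂ : ∫ ω in E, G ω ∂μ ≤
      a ^ n * (a * algRisk ψ P n A₀ A₁ + (1 - a) * B + B) - B * μ.real E := by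
    have e₁ : ∫ ω in E, (G ω + B) ∂μ = ∫ ω in E, G ω ∂μ + B * μ.real E := by
      rw [integral_add (integrable_of_mem_Icc hG hGB) (integrable_const _)]
      simp [mul_comm]
    have e₂ : ∫ ω in E, (G ω + B) ∂μ ≤ _ :=
      setIntegral_avoiding_le n P z ha volume (hG.add_const B) hG'
    have e₃ : ∫ ω, (G ω + B) ∂((Measure.pi fun _ : Fin n => P).prod volume) ≤
        a * algRisk ψ P n A₀ A₁ + (1 - a) * B + B := by
      have i₃ : Integrable (fun ω : (Fin n → X × Y) × I =>
          modelRisk ψ P (A₀.fit (List.ofFn ω.1) ω.2) (A₁.fit (List.ofFn ω.1) ω.2))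
          ((Measure.pi fun _ : Fin n => P).prod volume) :=
        integrable_of_mem_Icc (measurable_modelRisk hψ P A₀ A₁ n) fun ω =>
          modelRisk_mem_Icc hψ hB P (measurable_fit_section _ _ _) (measurable_fit_section _ _ _)
      calc _ ≤ ∫ ω : (Fin n → X × Y) × I, (a * modelRisk ψ P (A₀.fit (List.ofFn ω.1) ω.2)
              (A₁.fit (List.ofFn ω.1) ω.2) + ((1 - a) * B + B))
              ∂((Measure.pi fun _ : Fin n => P).prod volume) := by
            refine integral_mono (integrable_of_mem_Icc (hG.add_const B) hG')
              ((i₃.const_mul a).add (integrable_const _)) fun ω => ?_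
            have := modelRisk_contaminated hψ hB P z ha
              (measurable_fit_section A₀ ω.1 ω.2) (measurable_fit_section A₁ ω.1 ω.2)
            simp only [G]
            linarith
        _ = _ := by
          rw [integral_add (i₃.const_mul a) (integrable_const _), integral_const_mul]
          simp [algRisk, add_assoc]
    have := mul_le_mul_of_nonneg_left e₃ (pow_nonneg ha.1.le n)
    linarith
  have h₃ : ∫ ω in Eᶜ, modelRisk ψ P' g₀ g₁ ∂μ = (1 - μ.real E) * modelRisk ψ P' g₀ g₁ := by
    rw [setIntegral_const, probReal_compl_eq_one_sub hE, smul_eq_mul]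
  have h₄ := mul_le_mul_of_nonneg_left (modelRisk_contaminated hψ hB P z ha h₀ h₁)
    (sub_nonneg.2 (measureReal_le_one : μ.real E ≤ 1))
  rw [hsplit, h₃, ← hμE]
  linarith

end Trigger

/-! ### Behaviour of the test under the modification. -/

section Rejection

variable {X Y V : Type*} [MeasurableSpace X] [MeasurableSpace Y] [MeasurableSpace V] {N : ℕ}

theorem Procedure.IsTotalRounds.unique {T : Procedure X Y V N} {A₀ A₁ : Algorithm X Y V}
    {D : Fin N → X × Y} {ζ : ℕ → I} {r s : ℕ} (hr : T.IsTotalRounds A₀ A₁ D ζ r)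
    (hs : T.IsTotalRounds A₀ A₁ D ζ s) : r = s := by
  rcases lt_trichotomy r s with h | h | h
  · exact absurd hr.2.1 (hs.2.2 r hr.1 h)
  · exact h
  · exact absurd hs.2.1 (hr.2.2 s hs.1 h)

theorem Procedure.mem_rejection_iff {T : Procedure X Y V N} {A₀ A₁ : Algorithm X Y V}
    {ω : (Fin N → X × Y) × (ℕ → I) × I} {r : ℕ} (hr : T.IsTotalRounds A₀ A₁ ω.1 ω.2.1 r) :
    ω ∈ T.rejection A₀ A₁ ↔ T.output ω.1 (T.history A₀ A₁ ω.1 ω.2.1 r) ω.2.2 = true :=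
  ⟨fun ⟨_, hs, h⟩ => hr.unique hs ▸ h, fun h => ⟨r, hr, h⟩⟩

instance isProbabilityMeasure_testLaw (P : Measure (X × Y)) [IsProbabilityMeasure P] (N : ℕ) :
    IsProbabilityMeasure (testLaw P N) := by
  unfold testLaw
  infer_instance

theorem pow_mul_testLaw_real_le (P : Measure (X × Y)) [IsProbabilityMeasure P] (z : X × Y)
    {a : ℝ} (ha : a ∈ Set.Ioo (0 : ℝ) 1) [IsProbabilityMeasure (contaminated P z a)]
    (s : Set ((Fin N → X × Y) × (ℕ → I) × I)) :
    a ^ N * (testLaw P N).real s ≤ (testLaw (contaminated P z a) N).real s := by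
  have h := Measure.prod_mono (smul_pi_le_pi_contaminated N P z a)
    (le_refl ((Measure.infinitePi fun _ : ℕ => (volume : Measure I)).prod (volume : Measure I)))
  rw [Measure.prod_smul_left] at h
  have h' := ENNReal.toReal_mono (by finiteness : testLaw (contaminated P z a) N s ≠ ⊤) (h s)
  rw [Measure.smul_apply, smul_eq_mul, ENNReal.toReal_mul, ENNReal.toReal_pow,
    ENNReal.toReal_ofReal ha.1.le] at h'
  exact h'

variable [MeasurableSingletonClass X] [MeasurableSingletonClass Y]

/-- The procedure sees the algorithms only through models fitted to its queries. The condition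
concerns the queries of the original run alone. -/
theorem Procedure.history_trigger (T : Procedure X Y V N) (A₀ A₁ : Algorithm X Y V)
    (D : Fin N → X × Y) (ζ : ℕ → I) (z : X × Y) {g₀ g₁ : X → V} (h₀ : Measurable g₀)
    (h₁ : Measurable g₁) (r : ℕ)
    (hz : ∀ s < r, z ∉ (T.query D (T.history A₀ A₁ D ζ s) (ζ s)).1) :
    T.history (A₀.trigger z g₀ h₀) (A₁.trigger z g₁ h₁) D ζ r = T.history A₀ A₁ D ζ r := by
  induction r with
  | zero => rfl
  | succ r ih =>
    have h := hz r r.lt_succ_self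
    simp only [Procedure.history, ih fun s hs => hz s (hs.trans r.lt_succ_self),
      Algorithm.trigger_fit_of_notMem _ _ _ h]

theorem Procedure.mem_rejection_trigger_iff (T : Procedure X Y V N) (A₀ A₁ : Algorithm X Y V)
    (ω : (Fin N → X × Y) × (ℕ → I) × I) (z : X × Y) {g₀ g₁ : X → V} (h₀ : Measurable g₀)
    (h₁ : Measurable g₁) {r : ℕ} (hr : T.IsTotalRounds A₀ A₁ ω.1 ω.2.1 r)
    (hz : ∀ s < r, z ∉ (T.query ω.1 (T.history A₀ A₁ ω.1 ω.2.1 s) (ω.2.1 s)).1) :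
    ω ∈ T.rejection (A₀.trigger z g₀ h₀) (A₁.trigger z g₁ h₁) ↔ ω ∈ T.rejection A₀ A₁ := by
  have hist (s : ℕ) (hs : s ≤ r) :=
    T.history_trigger A₀ A₁ ω.1 ω.2.1 z h₀ h₁ s fun t ht => hz t (ht.trans_le hs)
  have hr' : T.IsTotalRounds (A₀.trigger z g₀ h₀) (A₁.trigger z g₁ h₁) ω.1 ω.2.1 r :=
    ⟨hr.1, (hist r le_rfl).symm ▸ hr.2.1,
      fun s hs hsr => (hist s hsr.le).symm ▸ hr.2.2 s hs hsr⟩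
  rw [mem_rejection_iff hr, mem_rejection_iff hr', hist r le_rfl]

/-- For a fixed terminating run, finitely many finite data sets are queried, and an injective
sequence eventually leaves them. The indicators of rejection thus converge almost surely. -/
theorem tendsto_real_rejection_trigger (T : BlackBoxTest X Y V N) (A₀ A₁ : Algorithm X Y V)
    (P : Measure (X × Y)) [IsProbabilityMeasure P] {z : ℕ → X × Y} (hz : Function.Injective z)
    {g₀ g₁ : X → V} (h₀ : Measurable g₀) (h₁ : Measurable g₁) :
    Tendsto (fun k => (testLaw P N).real
      (T.rejection (A₀.trigger (z k) g₀ h₀) (A₁.trigger (z k) g₁ h₁))) atTop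
      (𝓝 (T.rejectProb A₀ A₁ P)) := by
  refine (ENNReal.tendsto_toReal (by finiteness)).comp
    (tendsto_measure_of_ae_tendsto_indicator_of_isFiniteMeasure atTop
      (T.measurableSet_rejection A₀ A₁) (fun k => T.measurableSet_rejection _ _) ?_)
  filter_upwards [T.terminates A₀ A₁ P] with ω ⟨r, hr⟩
  have hfin (s : ℕ) : ∀ᶠ k in atTop,
      z k ∉ (T.query ω.1 (T.history A₀ A₁ ω.1 ω.2.1 s) (ω.2.1 s)).1 := by
    rw [← Nat.cofinite_eq_atTop]
    exact hz.tendsto_cofinite.eventually (List.finite_toSet _).eventually_cofinite_notMem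
  have hall : ∀ᶠ k in atTop, ∀ s ∈ Set.Iio r,
      z k ∉ (T.query ω.1 (T.history A₀ A₁ ω.1 ω.2.1 s) (ω.2.1 s)).1 :=
    (eventually_all_finite (Set.finite_Iio r)).2 fun s _ => hfin s
  filter_upwards [hall] with k hk
  exact T.mem_rejection_trigger_iff A₀ A₁ ω (z k) h₀ h₁ hr hk

end Rejection

/-! ### Numerical inequalities. -/

/-- The left side is the probability of at most one success in `m + 1` trials with success
probability `1 - a`. -/
theorem succ_mul_pow_add_pow_le_one {a : ℝ} (h0 : 0 ≤ a) (h1 : a ≤ 1) (m : ℕ) :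
    (m + 1) * (1 - a) * a ^ m + a ^ (m + 1) ≤ 1 := by
  induction m with
  | zero => simp
  | succ m ih =>
    have h2 : a ^ (m + 1) ≤ 1 := pow_le_one₀ h0 h1
    have h3 := mul_le_mul_of_nonneg_left ih h0
    have h4 := mul_le_mul_of_nonneg_left h2 (sub_nonneg.2 h1)
    push_cast
    calc _ = a * ((m + 1) * (1 - a) * a ^ m + a ^ (m + 1)) + (1 - a) * a ^ (m + 1) := by ring
      _ ≤ a * 1 + (1 - a) * 1 := add_le_add h3 h4
      _ = 1 := by ring

/-- The terms in `K` add up to `(1-a)a^m(1+a)K`, and `1 + a < 2` cancels the `1/2` in `hK`; the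
binomial bound does the rest. Strictness leaves room for the mass of `z` under `P`. -/
theorem stability_bound_lt {a K Γ : ℝ} (ha : a ∈ Set.Ioo (0 : ℝ) 1) (m : ℕ) (hΓ : 0 < Γ)
    (hK : K ≤ (m + 1) * Γ / 2) :
    a ^ (m + 1) * (a * Γ + (1 - a) * K) + (1 - a) * a ^ m * K < Γ := by
  have h1 : 0 < 1 - a := sub_pos.2 ha.2
  have h0 := ha.1
  have h2 := mul_le_mul_of_nonneg_right (succ_mul_pow_add_pow_le_one h0.le ha.2.le m) hΓ.le
  have h3 : (1 - a) * a ^ m * (1 + a) * K ≤ (1 - a) * a ^ m * (1 + a) * ((m + 1) * Γ / 2) :=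
    mul_le_mul_of_nonneg_left hK (by positivity)
  have h4 : 0 < (1 - a) * a ^ m * ((m + 1) * Γ) * (1 - a) := by positivity
  have h5 : 0 < a ^ (m + 1) * Γ * (1 - a) := by positivity
  rw [pow_succ] at *
  nlinarith

theorem two_mul_pow_le_of_le_rpow {B γ : ℝ} (hB : 0 ≤ B) {n q : ℕ} (hn : n ≠ 0) (hq : q ≠ 0)
    (h : 4 * B / (n : ℝ) ^ (1 / (q : ℝ)) ≤ γ) : (2 * B) ^ q ≤ n * γ ^ q / 2 := by
  have hn' : (0 : ℝ) < n := by positivity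
  have h1 : 4 * B ≤ γ * (n : ℝ) ^ (1 / (q : ℝ)) := (div_le_iff₀ (by positivity)).1 h
  have h2 := pow_le_pow_left₀ (by positivity) h1 q
  rw [mul_pow γ, one_div, Real.rpow_inv_natCast_pow hn'.le hq,
    show 4 * B = 2 * (2 * B) by ring, mul_pow 2] at h2
  -- The constant `4B`, twice the maximal change `2B`, yields a factor `2^q`, of which only `2` is
  -- needed.
  have h3 : (2 : ℝ) ≤ 2 ^ q := le_self_pow₀ (by norm_num) hq
  have h4 : 0 ≤ (2 * B) ^ q := by positivity
  nlinarith

/-- If the test data of a contaminated law are all drawn from `P` with a probability above the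
level, then the weight of the contamination is small. -/
theorem mul_one_sub_lt_of_lt_pow {a α B : ℝ} (ha : a ∈ Set.Ioo (0 : ℝ) 1) (hα : 0 < α)
    (hB : 0 < B) {N : ℕ} (hN : N ≠ 0) (h : α < a ^ N) :
    B * (1 - a) < a * (B * (α⁻¹ - 1) / N) := by
  have h0 := ha.1
  have hN' : (0 : ℝ) < N := by positivity
  -- Bernoulli's inequality for `a⁻¹`, the source of `B(α⁻¹ - 1)/N`.
  have h1 : 1 + N * (a⁻¹ - 1) ≤ (1 + (a⁻¹ - 1)) ^ N := by
    refine one_add_mul_le_pow ?_ N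
    have : 0 < a⁻¹ := inv_pos.2 h0
    linarith
  have h2 : (1 + (a⁻¹ - 1)) ^ N < α⁻¹ := by
    rw [add_sub_cancel, inv_pow]
    exact inv_strictAnti₀ hα h
  have h3 : a⁻¹ - 1 < (α⁻¹ - 1) / N := by
    rw [lt_div_iff₀ hN']
    linarith
  calc B * (1 - a) = a * (B * (a⁻¹ - 1)) := by field_simp
    _ < a * (B * ((α⁻¹ - 1) / N)) := by gcongr
    _ = _ := by ring

/-! ### The bound for a given contamination weight. -/

section

variable {X Y V : Type*} [MeasurableSpace X] [MeasurableSpace Y] [MeasurableSpace V]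
  {ψ : V → V → Y → ℝ} {B α γ a : ℝ} {n N q : ℕ}

theorem algRisk_mem_Icc (hψ : Measurable fun p : V × V × Y => ψ p.1 p.2.1 p.2.2)
    (hB : ∀ v v' y, ψ v v' y ∈ Set.Icc (-B) B) (P : Measure (X × Y)) [IsProbabilityMeasure P]
    (n : ℕ) (A₀ A₁ : Algorithm X Y V) : algRisk ψ P n A₀ A₁ ∈ Set.Icc (-B) B := by
  have hr (ω : (Fin n → X × Y) × I) := modelRisk_mem_Icc hψ hB P
    (measurable_fit_section A₀ ω.1 ω.2) (measurable_fit_section A₁ ω.1 ω.2)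
  have hi := integrable_of_mem_Icc (μ := (Measure.pi fun _ : Fin n => P).prod volume)
    (measurable_modelRisk hψ P A₀ A₁ n) hr
  constructor
  · simpa [algRisk] using integral_mono (integrable_const (-B)) hi fun ω => (hr ω).1
  · simpa [algRisk] using integral_mono hi (integrable_const B) fun ω => (hr ω).2

variable [MeasurableSingletonClass X] [MeasurableSingletonClass Y]

/-- `hrisk` is the limiting risk bound of the perturbed problem, as `P{z}` tends to `0`. Being
strict, it leaves room for near-optimal models and for a small `P{z}`. -/
theorem rejectProb_mul_pow_le [Infinite (X × Y)]
    (hψ : Measurable fun p : V × V × Y => ψ p.1 p.2.1 p.2.2)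
    (hψ_anti : ∀ v v' y, ψ v v' y = -ψ v' v y)
    (hB : ∀ v v' y, ψ v v' y ∈ Set.Icc (-B) B) (hB0 : 0 < B) (hn : n ≠ 0) (hq : q ≠ 0)
    (hγ : 4 * B / (n : ℝ) ^ (1 / (q : ℝ)) ≤ γ) (T : BlackBoxTest X Y V N)
    (hvalid : ∀ (A₀ A₁ : Algorithm X Y V) (P : Measure (X × Y)) [IsProbabilityMeasure P],
      stability ψ q P n A₀ A₁ ≤ γ → algRisk ψ P n A₀ A₁ ≤ 0 → T.rejectProb A₀ A₁ P ≤ α)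
    (A₀ A₁ : Algorithm X Y V) (P : Measure (X × Y)) [IsProbabilityMeasure P]
    (hstab : stability ψ q P n A₀ A₁ ≤ γ) (ha : a ∈ Set.Ioo (0 : ℝ) 1)
    (hrisk : a * (a ^ n * algRisk ψ P n A₀ A₁ - (1 - a ^ n) * maxRisk ψ P) + (1 - a) * B < 0) :
    a ^ N * T.rejectProb A₀ A₁ P ≤ α := by
  obtain ⟨m, rfl⟩ : ∃ m, n = m + 1 := Nat.exists_eq_succ_of_ne_zero hn
  set Δ := algRisk ψ P (m + 1) A₀ A₁
  have hγ0 : 0 < γ := lt_of_lt_of_le (by positivity) hγ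
  have han : 0 < 1 - a ^ (m + 1) := sub_pos.2 (pow_lt_one₀ ha.1.le ha.2 hn)
  -- measurable models whose risk is close to the maximum
  obtain ⟨g₀, g₁, h₀, h₁, hg⟩ : ∃ g₀ g₁ : X → V, Measurable g₀ ∧ Measurable g₁ ∧
      a * (a ^ (m + 1) * Δ - (1 - a ^ (m + 1)) * modelRisk ψ P g₀ g₁) + (1 - a) * B < 0 := by
    have hlt : (a ^ (m + 1) * Δ + (1 - a) * B / a) / (1 - a ^ (m + 1)) < maxRisk ψ P := by
      rw [div_lt_iff₀ han, ← sub_neg]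
      have : a * (a ^ (m + 1) * Δ + (1 - a) * B / a - maxRisk ψ P * (1 - a ^ (m + 1))) < 0 := by
        have e : a * ((1 - a) * B / a) = (1 - a) * B := mul_div_cancel₀ _ ha.1.ne'
        linarith
      exact neg_of_mul_neg_right this ha.1.le
    obtain ⟨_, ⟨g₀, g₁, h₀, h₁, rfl⟩, hd⟩ := exists_lt_of_lt_csSup
      -- Fits to the empty data set supply measurable models.
      (⟨_, _, _, measurable_fit_section A₀ ![] 0, measurable_fit_section A₁ ![] 0, rfl⟩ :
        {d | ∃ f₀ f₁ : X → V, Measurable f₀ ∧ Measurable f₁ ∧ d = modelRisk ψ P f₀ f₁}.Nonempty)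
      hlt
    refine ⟨g₀, g₁, h₀, h₁, ?_⟩
    rw [div_lt_iff₀ han] at hd
    have := mul_lt_mul_of_pos_left hd ha.1
    have e : a * ((1 - a) * B / a) = (1 - a) * B := mul_div_cancel₀ _ ha.1.ne'
    linarith
  have hswap : modelRisk ψ P g₁ g₀ = -modelRisk ψ P g₀ g₁ := by
    simp only [modelRisk, hψ_anti (g₁ _), integral_neg]
  let z : ℕ → X × Y := Infinite.natEmbedding (X × Y)
  have hz : Function.Injective z := (Infinite.natEmbedding (X × Y)).injective
  have hp := tendsto_measureReal_singleton P hz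
  have hs₀ := (stability_le_iff hq hγ0.le P hn A₀ A₁).1 hstab
  have hΓ : 0 < γ ^ q := pow_pos hγ0 q
  -- for large `k`, the modified algorithms satisfy the null hypothesis
  have hrisk' : ∀ᶠ k in atTop, algRisk ψ (contaminated P (z k) a) (m + 1)
      (A₀.trigger (z k) g₁ h₁) (A₁.trigger (z k) g₀ h₀) ≤ 0 := by
    have hc : Continuous fun p : ℝ =>
        a ^ (m + 1) * (a * Δ + (1 - a) * B + B) - B * (a * (1 - p)) ^ (m + 1) +
        (1 - (a * (1 - p)) ^ (m + 1)) * (a * modelRisk ψ P g₁ g₀ + (1 - a) * B) := by fun_prop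
    -- At `p = 0` the terms in `B` combine to `(1 - a)B`, which leaves exactly `hg`.
    have hev := ((hc.tendsto 0).comp hp).eventually_lt_const (u := 0) (by
      rw [hswap]
      simp only [sub_zero, mul_one]
      linarith)
    filter_upwards [hev] with k hk
    exact (algRisk_trigger_le hψ hB A₀ A₁ P (z k) ha h₁ h₀ (m + 1)).trans hk.le
  have hstab' : ∀ᶠ k in atTop, stability ψ q (contaminated P (z k) a) (m + 1)
      (A₀.trigger (z k) g₁ h₁) (A₁.trigger (z k) g₀ h₀) ≤ γ := by
    have hc : Continuous fun p : ℝ =>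
        a ^ (m + 1) * (a * γ ^ q + (1 - a) * (2 * B) ^ q) +
        (a * p + (1 - a)) * (a * (1 - p)) ^ m * (2 * B) ^ q := by fun_prop
    have hK := two_mul_pow_le_of_le_rpow hB0.le hn hq hγ
    push_cast at hK
    have hev := ((hc.tendsto 0).comp hp).eventually_lt_const (u := γ ^ q) (by
      simpa using stability_bound_lt ha m hΓ hK)
    filter_upwards [hev] with k hk
    refine (stability_le_iff hq hγ0.le _ hn _ _).2 fun j => ?_
    refine (integral_lossChange_trigger_le hψ hB A₀ A₁ P (z k) ha h₁ h₀ j hq).trans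
      (le_trans ?_ hk.le)
    have := ha.1
    have := hs₀ j
    dsimp only [Function.comp_apply]
    gcongr
  refine le_of_tendsto ((tendsto_real_rejection_trigger T A₀ A₁ P hz h₁ h₀).const_mul (a ^ N)) ?_
  filter_upwards [hrisk', hstab'] with k hk₁ hk₂
  have := isProbabilityMeasure_contaminated P (z k) ha
  exact (pow_mul_testLaw_real_le P (z k) ha _).trans (hvalid _ _ _ hk₂ hk₁)

end

end AlgComparison

end

/-! ### Choice of the weight. -/

theorem mainTheorem5 {X Y V : Type*}
    [MeasurableSpace X] [MeasurableSpace Y] [MeasurableSpace V]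
    [MeasurableSingletonClass X] [MeasurableSingletonClass Y]
    (hinf : Infinite X ∨ Infinite Y)
    (ψ : V → V → Y → ℝ)
    (hψ_meas : Measurable fun p : V × V × Y => ψ p.1 p.2.1 p.2.2)
    (hψ_anti : ∀ v v' y, ψ v v' y = -ψ v' v y)
    (B : ℝ) (hψ_bound : ∀ v v' y, ψ v v' y ∈ Set.Icc (-B) B)
    (α : ℝ) (hα : α ∈ Set.Ioo (0 : ℝ) 1)
    (n N : ℕ) (hn : 1 ≤ n) (hN : 1 ≤ N)
    (q : ℕ) (hq : q = 1 ∨ q = 2)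
    (γ : ℝ) (hγ : 4 * B / (n : ℝ) ^ (1 / (q : ℝ)) ≤ γ)
    (T : AlgComparison.BlackBoxTest X Y V N)
    (hvalid : ∀ (A₀ A₁ : AlgComparison.Algorithm X Y V)
      (P : MeasureTheory.Measure (X × Y)) [MeasureTheory.IsProbabilityMeasure P],
      AlgComparison.stability ψ q P n A₀ A₁ ≤ γ →
      AlgComparison.algRisk ψ P n A₀ A₁ ≤ 0 →
      T.rejectProb A₀ A₁ P ≤ α)
    (A₀ A₁ : AlgComparison.Algorithm X Y V)
    (P : MeasureTheory.Measure (X × Y)) [MeasureTheory.IsProbabilityMeasure P]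
    (hstab : AlgComparison.stability ψ q P n A₀ A₁ ≤ γ)
    (hrisk : 0 < AlgComparison.algRisk ψ P n A₀ A₁)
    (hmax : B * (α⁻¹ - 1) / (N : ℝ) < AlgComparison.maxRisk ψ P) :
    T.rejectProb A₀ A₁ P ≤
      min (α * (1 + (AlgComparison.algRisk ψ P n A₀ A₁ + B * (α⁻¹ - 1) / (N : ℝ)) /
          (AlgComparison.maxRisk ψ P - B * (α⁻¹ - 1) / (N : ℝ))) ^ ((N : ℝ) / (n : ℝ))) 1 := by
  open AlgComparison in
  have hB0 : 0 < B := hrisk.trans_le (algRisk_mem_Icc hψ_meas hψ_bound P n A₀ A₁).2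
  have hn0 : n ≠ 0 := by omega
  have hN0 : N ≠ 0 := by omega
  have hq0 : q ≠ 0 := by omega
  have hle1 : T.rejectProb A₀ A₁ P ≤ 1 := measureReal_le_one
  obtain ⟨x₀, y₀⟩ : Nonempty (X × Y) := P.nonempty_of_neZero
  have : Nonempty X := ⟨x₀⟩
  have : Nonempty Y := ⟨y₀⟩
  have : Infinite (X × Y) := by
    rcases hinf with h | h
    · exact Prod.infinite_of_left
    · exact Prod.infinite_of_right
  set Δ := algRisk ψ P n A₀ A₁
  set M := maxRisk ψ P
  set b := B * (α⁻¹ - 1) / (N : ℝ) with hb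
  have hb0 : 0 < b := by
    have : 1 < α⁻¹ := (one_lt_inv₀ hα.1).2 hα.2
    have : 0 < α⁻¹ - 1 := by linarith
    positivity
  have hMb : 0 < M - b := sub_pos.2 hmax
  have hΔM : 0 < Δ + M := by linarith
  have hρ0 : 0 < (M - b) / (Δ + M) := by positivity
  have hρ1 : (M - b) / (Δ + M) < 1 := (div_lt_one hΔM).2 (by linarith)
  -- This `a` solves `a^n Δ - (1 - a^n)M = -b`, so the risk condition becomes `(1 - a)B < ab`, and
  -- `α/a^N` is the claimed bound.
  obtain ⟨a, ha, han⟩ : ∃ a ∈ Set.Ioo (0 : ℝ) 1, a ^ n = (M - b) / (Δ + M) :=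
    ⟨((M - b) / (Δ + M)) ^ ((n : ℝ)⁻¹), ⟨by positivity,
      Real.rpow_lt_one hρ0.le hρ1 (by positivity)⟩, Real.rpow_inv_natCast_pow hρ0.le hn0⟩
  have hpow : (1 + (Δ + b) / (M - b)) ^ ((N : ℝ) / (n : ℝ)) = (a ^ N)⁻¹ := by
    have e : 1 + (Δ + b) / (M - b) = (a ^ n)⁻¹ := by
      rw [han, inv_div]
      field_simp
      ring
    have ha0 := ha.1.le
    rw [e, Real.inv_rpow (by positivity), ← Real.rpow_natCast a n, ← Real.rpow_mul ha0,
      mul_div_cancel₀ _ (by positivity), Real.rpow_natCast]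
  rw [hpow]
  have haN : 0 < a ^ N := pow_pos ha.1 N
  refine le_min ?_ hle1
  rw [← div_eq_mul_inv, le_div_iff₀ haN, mul_comm]
  -- If `a^N ≤ α`, the bound is at least `1` and nothing is to be shown. Otherwise `α < a^N` forces
  -- `(1 - a)B < ab`.
  rcases le_or_gt (a ^ N) α with h | h
  · exact (mul_le_of_le_one_right haN.le hle1).trans h
  · refine rejectProb_mul_pow_le hψ_meas hψ_anti hψ_bound hB0 hn0 hq0 hγ T hvalid A₀ A₁ P hstab ha ?_
    have hc := mul_one_sub_lt_of_lt_pow ha hα.1 hB0 hN0 h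
    have e : a ^ n * (Δ + M) = M - b := by rw [han, div_mul_cancel₀ _ hΔM.ne']
    have e' : a ^ n * Δ - (1 - a ^ n) * M = -b := by linarith
    change a * (a ^ n * Δ - (1 - a ^ n) * M) + (1 - a) * B < 0
    rw [e']
    linarith
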